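/- Let $\mathfrak g$ be a real Lie algebra of dimension $4$, let $g$ be an inner product on $\mathfrak g$, and let $J:\mathfrak g\to\mathfrak g$ be a linear map with $J^2=-\mathrm{Id}$ and $g(Jx,Jy)=g(x,y)$ for all $x,y\in\mathfrak g$. Put $\omega(x,y)=g(Jx,y)$. Let $\nabla$ be the Levi-Civita connection of the corresponding left-invariant metric, i.e. the bilinear map $\nabla:\mathfrak g\times\mathfrak g\to\mathfrak g$ determined by $$2g(\nabla_xy,z)=g([x,y],z)-g([y,z],x)+g([z,x],y)\qquad(x,y,z\in\mathfrak g),$$ and let $R_{xyzw}=g(\nabla_x\nabla_yz-\nabla_y\nabla_xz-\nabla_{[x,y]}z,\,w)$ be its curvature tensor. Assume that $J$ is integrable, that is, $$[Jx,Jy]-[x,y]-J[Jx,y]-J[x,Jy]=0\qquad\text{for all }x,y\in\mathfrak g,$$ and that Gray's first condition holds: $$R_{xyzw}=R_{xy\,Jz\,Jw}\qquad\text{for all }x,y,z,w\in\mathfrak g.$$ Then $(g,J,\omega)$ is a Kähler structure; that is, $J$ is integrable and $d\omega=0$, where $d\omega(x,y,z)=-\omega([x,y],z)-\omega([y,z],x)-\omega([z,x],y)$.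 -/

import Mathlib

/-- An almost Hermitian structure on a real Lie algebra `𝔤`: an inner product `g` and a
`g`-orthogonal complex structure `J` on the vector space `𝔤`. It is the value at the identity of a
left-invariant almost Hermitian structure on a Lie group with Lie algebra `𝔤`. -/
structure AlmostHermitianLieAlgebra (𝔤 : Type*) [LieRing 𝔤] [LieAlgebra ℝ 𝔤] where
  /-- the inner product -/
  g : LinearMap.BilinForm ℝ 𝔤
  symm : ∀ x y : 𝔤, g x y = g y x
  pos : ∀ x : 𝔤, x ≠ 0 → 0 < g x x
  /-- the almost complex structure -/
  J : 𝔤 →ₗ[ℝ] 𝔤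
  J_sq : ∀ x : 𝔤, J (J x) = -x
  J_orthogonal : ∀ x y : 𝔤, g (J x) (J y) = g x y

namespace AlmostHermitianLieAlgebra

variable {𝔤 : Type*} [LieRing 𝔤] [LieAlgebra ℝ 𝔤] (S : AlmostHermitianLieAlgebra 𝔤)

/-- The fundamental 2-form `ω(x, y) = g(J x, y)`. -/
def omega (x y : 𝔤) : ℝ := S.g (S.J x) y

/-- The exterior derivative of the left-invariant 2-form `ω`:
`dω(x, y, z) = - ω([x, y], z) - ω([y, z], x) - ω([z, x], y)`. The terms of the invariant formula
for `d` that differentiate functions vanish, `ω` being constant on left-invariant fields. -/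
def dOmega (x y z : 𝔤) : ℝ := -S.omega ⁅x, y⁆ z - S.omega ⁅y, z⁆ x - S.omega ⁅z, x⁆ y

/-- The Nijenhuis tensor of `J`. -/
def nijenhuis (x y : 𝔤) : 𝔤 := ⁅S.J x, S.J y⁆ - ⁅x, y⁆ - S.J ⁅S.J x, y⁆ - S.J ⁅x, S.J y⁆

/-- `J` is integrable, that is, the structure is Hermitian. -/
def IsHermitian : Prop := ∀ x y : 𝔤, S.nijenhuis x y = 0

/-- The structure is Kähler: `J` is integrable and the fundamental form is closed. -/
def IsKahler : Prop := S.IsHermitian ∧ ∀ x y z : 𝔤, S.dOmega x y z = 0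

theorem g_nondegenerate : S.g.Nondegenerate := by
  refine ⟨fun x hx => ?_, fun x hx => ?_⟩
  · by_contra h
    exact (S.pos x h).ne' (hx x)
  · by_contra h
    exact (S.pos x h).ne' (hx x)

/-- The right-hand side of the Koszul formula for left-invariant fields, as a functional of `z`:
`(g([x, y], z) - g([y, z], x) + g([z, x], y)) / 2`. -/
noncomputable def koszul (x y : 𝔤) : Module.Dual ℝ 𝔤 where
  toFun z := (S.g ⁅x, y⁆ z - S.g ⁅y, z⁆ x + S.g ⁅z, x⁆ y) / 2
  map_add' z w := by
    simp only [lie_add, add_lie, map_add, LinearMap.add_apply]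
    ring
  map_smul' t z := by
    simp only [lie_smul, smul_lie, map_smul, LinearMap.smul_apply, smul_eq_mul, RingHom.id_apply]
    ring

variable [FiniteDimensional ℝ 𝔤]

/-- The Levi-Civita connection `∇_x y` of the left-invariant metric `g` on left-invariant fields:
the vector that represents the Koszul functional with respect to `g`. -/
noncomputable def nabla (x y : 𝔤) : 𝔤 := (S.g.toDual S.g_nondegenerate).symm (S.koszul x y)

theorem g_nabla (x y z : 𝔤) :
    S.g (S.nabla x y) z = (S.g ⁅x, y⁆ z - S.g ⁅y, z⁆ x + S.g ⁅z, x⁆ y) / 2 :=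
  LinearMap.BilinForm.apply_toDual_symm_apply (hB := S.g_nondegenerate) (S.koszul x y) z

/-- The connection is metric. -/
theorem nabla_metric (x y z : 𝔤) : S.g (S.nabla x y) z + S.g y (S.nabla x z) = 0 := by
  rw [S.symm y, g_nabla, g_nabla, ← lie_skew x y, ← lie_skew x z, ← lie_skew z y]
  simp only [map_neg, LinearMap.neg_apply]
  ring

/-- The connection is torsion-free. -/
theorem nabla_torsion_free (x y : 𝔤) : S.nabla x y - S.nabla y x = ⁅x, y⁆ := by
  refine sub_eq_zero.1 (S.g_nondegenerate.1 _ fun z => ?_)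
  simp only [map_sub, LinearMap.sub_apply, g_nabla]
  rw [← lie_skew x y, ← lie_skew x z, ← lie_skew z y]
  simp only [map_neg, LinearMap.neg_apply]
  ring

/-- The Riemannian curvature tensor `R_{xyzw} = g(∇_x ∇_y z - ∇_y ∇_x z - ∇_{[x, y]} z, w)`. -/
noncomputable def curvature (x y z w : 𝔤) : ℝ :=
  S.g (S.nabla x (S.nabla y z) - S.nabla y (S.nabla x z) - S.nabla ⁅x, y⁆ z) w

/-- Gray's first curvature condition, `R_{xyzw} = R_{xy Jz Jw}`. -/
def GrayFirst : Prop :=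
  ∀ x y z w : 𝔤, S.curvature x y z w = S.curvature x y (S.J z) (S.J w)

end AlmostHermitianLieAlgebra

/-! Let `D x = [∇ x, J]` be the covariant derivative of `J`; closedness of `ω` follows from
`D = 0`. Integrability makes `D` complex linear in `x`, and Gray's condition `[R x y, J] = 0` says
that `D` is closed for the exterior covariant derivative: `D [x, y] = [∇ x, D y] - [∇ y, D x]`.

In dimension four the skew endomorphisms anticommuting with `J` form a complex line. Hence, if
`D ≠ 0`, its kernel is a complex line, spanned by a vector `a` which can be normalised so that
`D y a = y` for all `y` orthogonal to `a` and `J a`. The closedness of `D` then determines enough of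
the connection along `a`: for such `y`, `∇ y a = J y` and `∇ y (J a) = 0` modulo `a` and `J a`,
while `g (∇ v a) (J a) = -g v a` for all `v`. It follows that `ad y`, compressed to the plane of `a`
and `J a`, is symmetric and trace-free. Comparing the skew parts in the Jacobi identity for `y`,
`J y` and that plane yields, with `n = ∇ a a`,
`g a a * g y y + 2 * (g y n ^ 2 + g y (J n) ^ 2) = 0`, which is absurd for `y ≠ 0`.
-/

namespace AlmostHermitianLieAlgebra

variable {𝔤 : Type*} [LieRing 𝔤] [LieAlgebra ℝ 𝔤] {S : AlmostHermitianLieAlgebra 𝔤}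

section LinearAlgebra

theorem eq_of_g_eq {x y : 𝔤} (h : ∀ z, S.g x z = S.g y z) : x = y :=
  sub_eq_zero.1 <| S.g_nondegenerate.1 _ fun z => by
    rw [map_sub, LinearMap.sub_apply, h, sub_self]

theorem eq_zero_of_g_self {x : 𝔤} (h : S.g x x = 0) : x = 0 := by
  by_contra hx
  exact (S.pos x hx).ne' h

variable (S) in
theorem g_J_left (x y : 𝔤) : S.g (S.J x) y = -S.g x (S.J y) := by
  rw [← S.J_orthogonal x (S.J y), S.J_sq, map_neg, neg_neg]

variable (S) in
theorem g_self_J (x : 𝔤) : S.g x (S.J x) = 0 := by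
  linarith [S.g_J_left x x, S.symm x (S.J x)]

variable (S) in
theorem g_J_self (x : 𝔤) : S.g (S.J x) x = 0 := by
  rw [S.symm, g_self_J]

theorem J_ne_zero {x : 𝔤} (hx : x ≠ 0) : S.J x ≠ 0 := fun h =>
  hx <| by rw [← neg_eq_zero, ← S.J_sq, h, map_zero]

variable (S) in
/-- The orthogonal complement of the complex line spanned by `a`. -/
def complexOrthogonal (a : 𝔤) : Submodule ℝ 𝔤 :=
  LinearMap.ker ((S.g a).prod (S.g (S.J a)))

theorem mem_complexOrthogonal {a y : 𝔤} :
    y ∈ S.complexOrthogonal a ↔ S.g y a = 0 ∧ S.g y (S.J a) = 0 := by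
  simp [complexOrthogonal, S.symm y]

theorem mem_complexOrthogonal_comm {a b : 𝔤} :
    a ∈ S.complexOrthogonal b ↔ b ∈ S.complexOrthogonal a := by
  simp only [mem_complexOrthogonal, S.symm a, S.g_J_left b, neg_eq_zero]

theorem J_mem_complexOrthogonal {a y : 𝔤} (hy : y ∈ S.complexOrthogonal a) :
    S.J y ∈ S.complexOrthogonal a := by
  rw [mem_complexOrthogonal] at hy ⊢
  exact ⟨by rw [g_J_left, hy.2, neg_zero], by rw [S.J_orthogonal, hy.1]⟩

theorem exists_eq_add_mem_complexOrthogonal {a : 𝔤} (ha : a ≠ 0) (x : 𝔤) :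
    ∃ p q : ℝ, ∃ y ∈ S.complexOrthogonal a, x = p • a + q • S.J a + y := by
  have hc := (S.pos a ha).ne'
  refine ⟨S.g x a / S.g a a, S.g x (S.J a) / S.g a a, _, mem_complexOrthogonal.2 ⟨?_, ?_⟩,
    (add_sub_cancel _ x).symm⟩ <;>
  · simp only [map_sub, map_add, map_smul, LinearMap.sub_apply, LinearMap.add_apply,
      LinearMap.smul_apply, smul_eq_mul, g_self_J, g_J_self, J_orthogonal]
    field_simp
    ring

variable (S) in
theorem exists_ne_zero_mem_complexOrthogonal (hdim : Module.finrank ℝ 𝔤 = 4) (a : 𝔤) :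
    ∃ b ∈ S.complexOrthogonal a, b ≠ 0 := by
  have := FiniteDimensional.of_finrank_pos (K := ℝ) (V := 𝔤) (by omega)
  exact (Submodule.ne_bot_iff _).1 <| LinearMap.ker_ne_bot_of_finrank_lt (by simp [hdim])

theorem eq_zero_of_mem_complexOrthogonal (hdim : Module.finrank ℝ 𝔤 = 4) {a b x : 𝔤} (ha : a ≠ 0)
    (hb : b ≠ 0) (hba : b ∈ S.complexOrthogonal a) (hxa : x ∈ S.complexOrthogonal a)
    (hxb : x ∈ S.complexOrthogonal b) : x = 0 := by
  by_contra hx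
  have := FiniteDimensional.of_finrank_pos (K := ℝ) (V := 𝔤) (by omega)
  let v : Fin 5 → 𝔤 := ![a, S.J a, b, S.J b, x]
  have hortho : S.g.IsOrthoᵢ v := by
    have hab := mem_complexOrthogonal.1 (mem_complexOrthogonal_comm.2 hba)
    have hax := mem_complexOrthogonal.1 (mem_complexOrthogonal_comm.2 hxa)
    have hbx := mem_complexOrthogonal.1 (mem_complexOrthogonal_comm.2 hxb)
    rw [mem_complexOrthogonal] at hba hxa hxb
    rw [LinearMap.isOrthoᵢ_def]
    intro i j hij
    fin_cases i <;> fin_cases j <;>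
      simp_all [v, S.g_J_left, S.J_sq, g_self_J]
  have hself (i : Fin 5) : ¬ S.g (v i) (v i) = 0 := by
    refine fun h => (?_ : v i ≠ 0) (eq_zero_of_g_self h)
    fin_cases i <;> simp [v, ha, hb, hx, J_ne_zero]
  have hcard := (LinearMap.linearIndependent_of_isOrthoᵢ hortho hself).fintype_card_le_finrank
  simp [hdim] at hcard

theorem exists_eq_smul_add_smul_J (hdim : Module.finrank ℝ 𝔤 = 4) {a b y : 𝔤} (ha : a ≠ 0)
    (hb : b ≠ 0) (hba : b ∈ S.complexOrthogonal a) (hy : y ∈ S.complexOrthogonal a) :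
    ∃ p q : ℝ, y = p • b + q • S.J b := by
  obtain ⟨p, q, z, hz, rfl⟩ := exists_eq_add_mem_complexOrthogonal (S := S) hb y
  have hline : p • b + q • S.J b ∈ S.complexOrthogonal a :=
    add_mem (Submodule.smul_mem _ _ hba) (Submodule.smul_mem _ _ (J_mem_complexOrthogonal hba))
  have hza : z ∈ S.complexOrthogonal a := (Submodule.add_mem_iff_right _ hline).1 hy
  exact ⟨p, q, by rw [eq_zero_of_mem_complexOrthogonal hdim ha hb hba hza hz, add_zero]⟩

variable (S) in
/-- A skew endomorphism that anticommutes with `J`; under `g` these correspond to the real 2-forms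
of type `(2, 0) + (0, 2)`. -/
structure IsSkewAntilinear (A : Module.End ℝ 𝔤) : Prop where
  skew : ∀ x y, S.g (A x) y = -S.g x (A y)
  map_J : ∀ x, A (S.J x) = -S.J (A x)

namespace IsSkewAntilinear

variable {A : Module.End ℝ 𝔤}

theorem apply_mem_complexOrthogonal (hA : S.IsSkewAntilinear A) (x : 𝔤) :
    A x ∈ S.complexOrthogonal x := by
  refine mem_complexOrthogonal.2 ⟨by linarith [hA.skew x x, S.symm (A x) x], ?_⟩
  have h := hA.skew x (S.J x)
  rw [hA.map_J, map_neg, neg_neg, S.symm x, g_J_left] at h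
  linarith

theorem eq_zero_of_apply_eq_zero (hA : S.IsSkewAntilinear A) (hdim : Module.finrank ℝ 𝔤 = 4)
    {a : 𝔤} (ha : a ≠ 0) (hAa : A a = 0) : A = 0 := by
  have hAJa : A (S.J a) = 0 := by rw [hA.map_J, hAa, map_zero, neg_zero]
  ext x
  obtain ⟨p, q, y, hy, rfl⟩ := exists_eq_add_mem_complexOrthogonal (S := S) ha x
  simp only [map_add, map_smul, hAa, hAJa, smul_zero, zero_add, LinearMap.zero_apply]
  rcases eq_or_ne y 0 with rfl | hy0
  · exact map_zero A
  · refine eq_zero_of_mem_complexOrthogonal hdim ha hy0 hy ?_ (hA.apply_mem_complexOrthogonal y)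
    simp only [mem_complexOrthogonal, hA.skew, hAa, hAJa, map_zero, neg_zero, and_self]

theorem g_apply_eq_zero (hA : S.IsSkewAntilinear A) (hdim : Module.finrank ℝ 𝔤 = 4)
    {a v w : 𝔤} (ha : a ≠ 0) (hv : v ∈ S.complexOrthogonal a) (hw : w ∈ S.complexOrthogonal a) :
    S.g (A v) w = 0 := by
  rcases eq_or_ne v 0 with rfl | hv0
  · simp only [map_zero, LinearMap.zero_apply]
  · obtain ⟨p, q, rfl⟩ := exists_eq_smul_add_smul_J hdim ha hv0 hv hw
    have hAv := mem_complexOrthogonal.1 (hA.apply_mem_complexOrthogonal v)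
    simp only [map_add, map_smul, hAv, smul_zero, add_zero]

end IsSkewAntilinear

end LinearAlgebra

variable [FiniteDimensional ℝ 𝔤]

section Connection

variable (S)

/-- The Levi-Civita connection `x ↦ ∇ x`, bundled as a linear map into endomorphisms. -/
noncomputable def connection : 𝔤 →ₗ[ℝ] Module.End ℝ 𝔤 :=
  LinearMap.mk₂ ℝ S.nabla
    (fun x x' y => eq_of_g_eq (S := S) fun z => by
      simp only [map_add, LinearMap.add_apply, g_nabla, add_lie, lie_add]; ring)
    (fun r x y => eq_of_g_eq (S := S) fun z => by
      simp only [map_smul, LinearMap.smul_apply, g_nabla, smul_lie, lie_smul, smul_eq_mul]; ring)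
    (fun x y y' => eq_of_g_eq (S := S) fun z => by
      simp only [map_add, LinearMap.add_apply, g_nabla, add_lie, lie_add]; ring)
    (fun r x y => eq_of_g_eq (S := S) fun z => by
      simp only [map_smul, LinearMap.smul_apply, g_nabla, smul_lie, lie_smul, smul_eq_mul]; ring)

theorem g_connection_left (x y z : 𝔤) :
    S.g (S.connection x y) z = -S.g y (S.connection x z) :=
  eq_neg_of_add_eq_zero_left (S.nabla_metric x y z)

theorem g_connection_self (x y : 𝔤) : S.g (S.connection x y) y = 0 := by
  linarith [S.g_connection_left x y y, S.symm (S.connection x y) y]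

theorem lie_eq_connection_sub (x y : 𝔤) : ⁅x, y⁆ = S.connection x y - S.connection y x :=
  (S.nabla_torsion_free x y).symm

theorem g_lie_right_self (x y : 𝔤) : S.g ⁅x, y⁆ y = S.g x (S.connection y y) := by
  rw [lie_eq_connection_sub, map_sub, LinearMap.sub_apply, g_connection_self, g_connection_left,
    zero_sub, neg_neg]

/-- The covariant derivative `∇ x J`, as the commutator of `∇ x` with `J`. -/
noncomputable def nablaJ : 𝔤 →ₗ[ℝ] Module.End ℝ 𝔤 where
  toFun x := ⁅S.connection x, (S.J : Module.End ℝ 𝔤)⁆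
  map_add' x y := by
    simp only [Ring.lie_def, map_add, add_mul, mul_add, add_sub_add_comm]
  map_smul' r x := by
    simp only [Ring.lie_def, map_smul, smul_mul_assoc, mul_smul_comm, smul_sub, RingHom.id_apply]

theorem nablaJ_eq_lie (x : 𝔤) : S.nablaJ x = ⁅S.connection x, (S.J : Module.End ℝ 𝔤)⁆ := rfl

theorem nablaJ_apply (x y : 𝔤) :
    S.nablaJ x y = S.connection x (S.J y) - S.J (S.connection x y) := rfl

theorem isSkewAntilinear_nablaJ (x : 𝔤) : S.IsSkewAntilinear (S.nablaJ x) where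
  skew y z := by
    simp only [nablaJ_apply, map_sub, LinearMap.sub_apply, g_connection_left, g_J_left]
    ring
  map_J y := by
    simp only [nablaJ_apply, S.J_sq, map_sub, map_neg]
    abel

theorem nijenhuis_eq_nablaJ (x y : 𝔤) :
    S.nijenhuis x y = (S.nablaJ (S.J x) y - S.J (S.nablaJ x y))
      - (S.nablaJ (S.J y) x - S.J (S.nablaJ y x)) := by
  simp only [nijenhuis, nablaJ_apply, S.lie_eq_connection_sub, map_sub, S.J_sq]
  abel

theorem dOmega_eq_nablaJ (x y z : 𝔤) :
    S.dOmega x y z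
      = S.g (S.nablaJ x y) z + S.g (S.nablaJ y z) x + S.g (S.nablaJ z x) y := by
  have hnabla (u v w : 𝔤) :
      S.g (S.nablaJ u v) w = -S.omega (S.connection u v) w + S.omega (S.connection u w) v := by
    rw [nablaJ_apply, map_sub, LinearMap.sub_apply, g_connection_left, omega, omega,
      S.g_J_left (S.connection u w), S.symm (S.connection u w), g_J_left]
    ring
  simp only [hnabla, dOmega, S.lie_eq_connection_sub, omega, map_sub, LinearMap.sub_apply]
  ring

variable {S}

theorem nablaJ_J (hherm : S.IsHermitian) (x y : 𝔤) : S.nablaJ (S.J x) y = S.J (S.nablaJ x y) := by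
  let E (x y z : 𝔤) : ℝ := S.g (S.nablaJ (S.J x) y - S.J (S.nablaJ x y)) z
  have hsymm (x y z : 𝔤) : E x y z = E y x z := by
    rw [← sub_eq_zero]
    simp only [E, ← LinearMap.sub_apply, ← map_sub, ← nijenhuis_eq_nablaJ, hherm x y, map_zero,
      LinearMap.zero_apply]
  have hskew (x y z : 𝔤) : E x y z = -E x z y := by
    simp only [E, map_sub, LinearMap.sub_apply, g_J_left, (S.isSkewAntilinear_nablaJ _).skew,
      (S.isSkewAntilinear_nablaJ _).map_J, map_neg, S.symm y, neg_neg]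
    ring
  refine sub_eq_zero.1 (eq_of_g_eq (S := S) fun z => ?_)
  rw [map_zero, LinearMap.zero_apply]
  change E x y z = 0
  -- A trilinear form symmetric in its first two and skew in its last two arguments vanishes.
  linarith [hsymm x y z, hskew y x z, hsymm y z x, hskew z y x, hsymm z x y, hskew x z y]

theorem curvature_eq_g (x y z w : 𝔤) :
    S.curvature x y z w
      = S.g ((⁅S.connection x, S.connection y⁆ - S.connection ⁅x, y⁆) z) w := rfl

theorem lie_curvature_J (hG : S.GrayFirst) (x y : 𝔤) :
    ⁅⁅S.connection x, S.connection y⁆ - S.connection ⁅x, y⁆, (S.J : Module.End ℝ 𝔤)⁆ = 0 := by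
  ext z
  refine eq_of_g_eq (S := S) fun w => ?_
  have h := hG x y z (S.J w)
  rw [S.J_sq, curvature_eq_g, curvature_eq_g, map_neg] at h
  rw [Ring.lie_def, LinearMap.sub_apply, Module.End.mul_apply, Module.End.mul_apply, map_sub,
    LinearMap.sub_apply, g_J_left, h, LinearMap.zero_apply, map_zero, LinearMap.zero_apply]
  ring

theorem nablaJ_lie (hG : S.GrayFirst) (x y : 𝔤) :
    S.nablaJ ⁅x, y⁆ = ⁅S.connection x, S.nablaJ y⁆ - ⁅S.connection y, S.nablaJ x⁆ := by
  have h := lie_curvature_J hG x y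
  simp only [nablaJ_eq_lie, Ring.lie_def] at h ⊢
  rw [← sub_eq_zero, ← neg_eq_zero, ← h]
  noncomm_ring

end Connection

variable (S) in
/-- A vector `a` whose complex line is the kernel of `x ↦ ∇ x J`, normalised by `(∇ y J) a = y` on
the orthogonal complement of that line. In a Hermitian structure of real dimension four with Lee
form `θ` it is a multiple of the anti-Lee vector `J θ♯`. -/
structure IsAntiLeeVector (a : 𝔤) : Prop where
  ne_zero : a ≠ 0
  complexOrthogonal_ne_bot : S.complexOrthogonal a ≠ ⊥
  nablaJ_self : S.nablaJ a = 0
  nablaJ_J_self : S.nablaJ (S.J a) = 0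
  nablaJ_apply_self : ∀ y ∈ S.complexOrthogonal a, S.nablaJ y a = y
  g_nablaJ : ∀ y, ∀ v ∈ S.complexOrthogonal a, ∀ w ∈ S.complexOrthogonal a,
    S.g (S.nablaJ y v) w = 0

section Existence

theorem exists_nablaJ_eq_zero (hdim : Module.finrank ℝ 𝔤 = 4) : ∃ a ≠ 0, S.nablaJ a = 0 := by
  have : Nontrivial 𝔤 := Module.nontrivial_of_finrank_pos (R := ℝ) (by omega)
  obtain ⟨u, hu⟩ := exists_ne (0 : 𝔤)
  obtain ⟨v, hvu, hv⟩ := S.exists_ne_zero_mem_complexOrthogonal hdim u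
  let D := S.nablaJ.flip u
  obtain ⟨a, hDa, ha⟩ := (Submodule.ne_bot_iff _).1 <|
    LinearMap.ker_ne_bot_of_finrank_lt (f := (S.g v ∘ₗ D).prod (S.g (S.J v) ∘ₗ D)) (by simp [hdim])
  have hDav : S.nablaJ a u ∈ S.complexOrthogonal v := hDa
  have hA := S.isSkewAntilinear_nablaJ a
  exact ⟨a, ha, hA.eq_zero_of_apply_eq_zero hdim hu <|
    eq_zero_of_mem_complexOrthogonal hdim hu hv hvu (hA.apply_mem_complexOrthogonal u) hDav⟩

theorem nablaJ_J_eq_zero (hherm : S.IsHermitian) {a : 𝔤} (ha : S.nablaJ a = 0) :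
    S.nablaJ (S.J a) = 0 := by
  ext y
  rw [nablaJ_J hherm, ha, LinearMap.zero_apply, map_zero]

theorem exists_isAntiLeeVector (hdim : Module.finrank ℝ 𝔤 = 4) (hherm : S.IsHermitian)
    (hD : S.nablaJ ≠ 0) : ∃ a, S.IsAntiLeeVector a := by
  obtain ⟨u, hu, hDu⟩ := exists_nablaJ_eq_zero (S := S) hdim
  have hDJu := nablaJ_J_eq_zero hherm hDu
  obtain ⟨b, hbu, hDb⟩ : ∃ b ∈ S.complexOrthogonal u, S.nablaJ b ≠ 0 := by
    by_contra! h
    refine hD (LinearMap.ext fun x => ?_)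
    obtain ⟨p, q, y, hy, rfl⟩ := exists_eq_add_mem_complexOrthogonal (S := S) hu x
    simp only [map_add, map_smul, hDu, hDJu, h y hy, smul_zero, add_zero, LinearMap.zero_apply]
  have hb : b ≠ 0 := by
    rintro rfl
    exact hDb (map_zero _)
  have hA := S.isSkewAntilinear_nablaJ b
  have hinj : Function.Injective (S.nablaJ b) := (injective_iff_map_eq_zero _).2 fun x hx => by
    by_contra hx0
    exact hDb (hA.eq_zero_of_apply_eq_zero hdim hx0 hx)
  obtain ⟨a, ha⟩ := LinearMap.surjective_of_injective hinj b
  have ha0 : a ≠ 0 := by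
    rintro rfl
    exact hb (by rw [← ha, map_zero])
  have hba : b ∈ S.complexOrthogonal a := by simpa only [ha] using hA.apply_mem_complexOrthogonal a
  have hDa : S.nablaJ a = 0 := by
    obtain ⟨p, q, rfl⟩ := exists_eq_smul_add_smul_J hdim hb hu (mem_complexOrthogonal_comm.2 hbu)
      (mem_complexOrthogonal_comm.2 hba)
    simp only [map_add, map_smul, hDu, hDJu, smul_zero, add_zero]
  refine ⟨a, ha0, (Submodule.ne_bot_iff _).2 ⟨b, hba, hb⟩, hDa, nablaJ_J_eq_zero hherm hDa,
    fun y hy => ?_, fun y v hv w hw =>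
      (S.isSkewAntilinear_nablaJ y).g_apply_eq_zero hdim ha0 hv hw⟩
  obtain ⟨p, q, rfl⟩ := exists_eq_smul_add_smul_J hdim ha0 hb hba hy
  simp only [map_add, map_smul, LinearMap.add_apply, LinearMap.smul_apply, nablaJ_J hherm, ha]

end Existence

namespace IsAntiLeeVector

variable {a y v w : 𝔤}

theorem g_nablaJ_apply (ha : S.IsAntiLeeVector a) (hy : y ∈ S.complexOrthogonal a)
    (hw : w ∈ S.complexOrthogonal a) (v : 𝔤) :
    S.g a a * S.g (S.nablaJ y v) w = S.g v a * S.g y w - S.g v (S.J a) * S.g (S.J y) w := by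
  obtain ⟨p, q, z, hz, rfl⟩ := exists_eq_add_mem_complexOrthogonal (S := S) ha.ne_zero v
  simp only [map_add, map_smul, LinearMap.add_apply, LinearMap.smul_apply, smul_eq_mul,
    (S.isSkewAntilinear_nablaJ y).map_J, ha.nablaJ_apply_self y hy, ha.g_nablaJ y z hz w hw,
    map_neg, LinearMap.neg_apply, g_self_J, g_J_self, J_orthogonal, mem_complexOrthogonal.1 hz]
  ring

theorem g_nablaJ_self (ha : S.IsAntiLeeVector a) (hw : w ∈ S.complexOrthogonal a) (x : 𝔤) :
    S.g (S.nablaJ x a) w = S.g x w := by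
  obtain ⟨p, q, y, hy, rfl⟩ := exists_eq_add_mem_complexOrthogonal (S := S) ha.ne_zero x
  have hw' := mem_complexOrthogonal.1 hw
  simp only [map_add, map_smul, LinearMap.add_apply, LinearMap.smul_apply, smul_eq_mul,
    ha.nablaJ_self, ha.nablaJ_J_self, ha.nablaJ_apply_self y hy, S.symm a, S.symm (S.J a), hw',
    LinearMap.zero_apply, map_zero, mul_zero, add_zero]

theorem g_lie_eq (hG : S.GrayFirst) (ha : S.IsAntiLeeVector a) (hw : w ∈ S.complexOrthogonal a)
    (x y : 𝔤) :
    S.g ⁅x, y⁆ w = S.g (S.connection x (S.nablaJ y a)) w - S.g (S.nablaJ y (S.connection x a)) w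
      - (S.g (S.connection y (S.nablaJ x a)) w - S.g (S.nablaJ x (S.connection y a)) w) := by
  rw [← ha.g_nablaJ_self hw, nablaJ_lie hG]
  simp only [Ring.lie_def, LinearMap.sub_apply, Module.End.mul_apply, map_sub]

theorem g_connection_of_nablaJ_eq_zero (hG : S.GrayFirst) (ha : S.IsAntiLeeVector a) {x : 𝔤}
    (hx : S.nablaJ x = 0) (hy : y ∈ S.complexOrthogonal a) (hw : w ∈ S.complexOrthogonal a) :
    S.g a a * S.g (S.connection y x) w = -S.g (S.connection x a) (S.J a) * S.g (S.J y) w := by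
  have hlie := ha.g_lie_eq hG hw x y
  have hcomp := ha.g_nablaJ_apply hy hw (S.connection x a)
  rw [S.lie_eq_connection_sub, hx, ha.nablaJ_apply_self y hy] at hlie
  simp only [map_sub, LinearMap.sub_apply, LinearMap.zero_apply, map_zero] at hlie
  rw [g_connection_self] at hcomp
  linear_combination hcomp - S.g a a * hlie

theorem g_self_mul_g (hG : S.GrayFirst) (ha : S.IsAntiLeeVector a)
    (hy : y ∈ S.complexOrthogonal a) (hw : w ∈ S.complexOrthogonal a) :
    S.g a a * S.g y w = -S.g (S.connection (S.J a) a) (S.J a) * S.g (S.J y) w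
      - S.g (S.connection a a) (S.J a) * S.g y w := by
  have hself := ha.g_connection_of_nablaJ_eq_zero hG ha.nablaJ_self hy (J_mem_complexOrthogonal hw)
  have hJ := ha.g_connection_of_nablaJ_eq_zero hG ha.nablaJ_J_self hy hw
  have hdef := congrArg (S.g · w) (ha.nablaJ_apply_self y hy)
  simp only [nablaJ_apply, map_sub, LinearMap.sub_apply, g_J_left] at hdef
  rw [J_orthogonal] at hself
  linear_combination hself + hJ - S.g a a * hdef

theorem g_connection_orthogonal_self_J (hG : S.GrayFirst) (ha : S.IsAntiLeeVector a)
    (hy : y ∈ S.complexOrthogonal a) : S.g (S.connection y a) (S.J a) = 0 := by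
  rcases eq_or_ne y 0 with rfl | hy0
  · simp only [map_zero, LinearMap.zero_apply]
  have hJy := J_mem_complexOrthogonal hy
  have hlie := ha.g_lie_eq hG hy y (S.J y)
  rw [ha.nablaJ_apply_self y hy, ha.nablaJ_apply_self _ hJy, S.lie_eq_connection_sub] at hlie
  simp only [map_sub, LinearMap.sub_apply] at hlie
  have h₁ := ha.g_nablaJ_apply hJy hy (S.connection y a)
  have h₂ := ha.g_nablaJ_apply hy hy (S.connection (S.J y) a)
  simp only [g_connection_self, g_J_self, S.J_sq, map_neg, LinearMap.neg_apply] at h₁ h₂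
  refine (mul_eq_zero.1 ?_).resolve_right (S.pos y hy0).ne'
  linear_combination -h₁ + h₂ + S.g a a * hlie

theorem g_connection_self_self_J (hG : S.GrayFirst) (ha : S.IsAntiLeeVector a) :
    S.g (S.connection a a) (S.J a) = -S.g a a := by
  obtain ⟨y, hy, hy0⟩ := (Submodule.ne_bot_iff _).1 ha.complexOrthogonal_ne_bot
  have h := ha.g_self_mul_g hG hy hy
  rw [g_J_self] at h
  exact mul_right_cancel₀ (S.pos y hy0).ne' (by linear_combination h)

theorem g_connection_J_self_self_J (hG : S.GrayFirst) (ha : S.IsAntiLeeVector a) :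
    S.g (S.connection (S.J a) a) (S.J a) = 0 := by
  obtain ⟨y, hy, hy0⟩ := (Submodule.ne_bot_iff _).1 ha.complexOrthogonal_ne_bot
  have h := ha.g_self_mul_g hG hy (J_mem_complexOrthogonal hy)
  rw [g_self_J, J_orthogonal] at h
  exact (mul_eq_zero.1 (by linear_combination h)).resolve_right (S.pos y hy0).ne'

theorem g_connection_self_J (hG : S.GrayFirst) (ha : S.IsAntiLeeVector a) (v : 𝔤) :
    S.g (S.connection v a) (S.J a) = -S.g v a := by
  obtain ⟨p, q, y, hy, rfl⟩ := exists_eq_add_mem_complexOrthogonal (S := S) ha.ne_zero v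
  simp only [map_add, map_smul, LinearMap.add_apply, LinearMap.smul_apply, smul_eq_mul,
    ha.g_connection_self_self_J hG, ha.g_connection_J_self_self_J hG,
    ha.g_connection_orthogonal_self_J hG hy, mem_complexOrthogonal.1 hy, g_J_self]
  ring

theorem g_connection_orthogonal_self (hG : S.GrayFirst) (ha : S.IsAntiLeeVector a)
    (hy : y ∈ S.complexOrthogonal a) (hw : w ∈ S.complexOrthogonal a) :
    S.g (S.connection y a) w = S.g (S.J y) w := by
  have h := ha.g_connection_of_nablaJ_eq_zero hG ha.nablaJ_self hy hw
  rw [ha.g_connection_self_self_J hG, neg_neg] at h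
  exact mul_left_cancel₀ (S.pos a ha.ne_zero).ne' h

theorem g_connection_orthogonal_J (hG : S.GrayFirst) (ha : S.IsAntiLeeVector a)
    (hy : y ∈ S.complexOrthogonal a) (hw : w ∈ S.complexOrthogonal a) :
    S.g (S.connection y (S.J a)) w = 0 := by
  have h := ha.g_connection_of_nablaJ_eq_zero hG ha.nablaJ_J_self hy hw
  rw [ha.g_connection_J_self_self_J hG, neg_zero, zero_mul] at h
  exact (mul_eq_zero.1 h).resolve_left (S.pos a ha.ne_zero).ne'

theorem lie_self_J (hG : S.GrayFirst) (ha : S.IsAntiLeeVector a) : ⁅a, S.J a⁆ = a := by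
  refine eq_of_g_eq (S := S) fun v => ?_
  obtain ⟨p, q, w, hw, rfl⟩ := exists_eq_add_mem_complexOrthogonal (S := S) ha.ne_zero v
  have hself : S.g ⁅a, S.J a⁆ a = S.g a a := by
    rw [S.lie_eq_connection_sub, map_sub, LinearMap.sub_apply, g_connection_self, g_connection_left,
      S.symm (S.J a), ha.g_connection_self_self_J hG, neg_neg, sub_zero]
  have hJ : S.g ⁅a, S.J a⁆ (S.J a) = 0 := by
    rw [S.lie_eq_connection_sub, map_sub, LinearMap.sub_apply, g_connection_self,
      ha.g_connection_J_self_self_J hG, sub_zero]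
  have horth : S.g ⁅a, S.J a⁆ w = 0 := by
    simp only [ha.g_lie_eq hG hw, ha.nablaJ_self, ha.nablaJ_J_self, LinearMap.zero_apply, map_zero,
      sub_zero]
  simp only [map_add, map_smul, smul_eq_mul, hself, hJ, horth, g_self_J, S.symm a w,
    mem_complexOrthogonal.1 hw]

theorem connection_self_J (ha : S.IsAntiLeeVector a) :
    S.connection a (S.J a) = S.J (S.connection a a) := by
  rw [← sub_eq_zero, ← nablaJ_apply, ha.nablaJ_self, LinearMap.zero_apply]

theorem connection_J_self (hG : S.GrayFirst) (ha : S.IsAntiLeeVector a) :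
    S.connection (S.J a) a = S.J (S.connection a a) - a := by
  rw [← ha.connection_self_J, eq_sub_iff_add_eq, ← eq_sub_iff_add_eq', ← S.lie_eq_connection_sub,
    ha.lie_self_J hG]

theorem connection_J_J (hG : S.GrayFirst) (ha : S.IsAntiLeeVector a) :
    S.connection (S.J a) (S.J a) = -S.connection a a - S.J a := by
  have h := S.nablaJ_apply (S.J a) a
  rw [ha.nablaJ_J_self, LinearMap.zero_apply, ha.connection_J_self hG, map_sub, S.J_sq] at h
  exact sub_eq_zero.1 h.symm

theorem g_lie_self_J (hG : S.GrayFirst) (ha : S.IsAntiLeeVector a) (v : 𝔤) :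
    S.g ⁅v, a⁆ (S.J a) = S.g v (S.J (S.connection a a)) - S.g v a := by
  rw [S.lie_eq_connection_sub, map_sub, LinearMap.sub_apply, ha.g_connection_self_J hG,
    S.g_connection_left a v, ha.connection_self_J]
  ring

theorem g_lie_J_self (hG : S.GrayFirst) (ha : S.IsAntiLeeVector a) (v : 𝔤) :
    S.g ⁅v, S.J a⁆ a = S.g v (S.J (S.connection a a)) := by
  rw [S.lie_eq_connection_sub, map_sub, LinearMap.sub_apply, g_connection_left,
    S.g_connection_left (S.J a) v, S.symm (S.J a), ha.g_connection_self_J hG,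
    ha.connection_J_self hG, map_sub]
  ring

theorem g_lie_J_J (hG : S.GrayFirst) (ha : S.IsAntiLeeVector a) (v : 𝔤) :
    S.g ⁅v, S.J a⁆ (S.J a) = -S.g v (S.connection a a) - S.g v (S.J a) := by
  rw [S.lie_eq_connection_sub, map_sub, LinearMap.sub_apply, g_connection_self,
    S.g_connection_left (S.J a) v, ha.connection_J_J hG, map_sub, map_neg]
  ring

theorem g_lie_orthogonal_self (hG : S.GrayFirst) (ha : S.IsAntiLeeVector a)
    (hy : y ∈ S.complexOrthogonal a) (hw : w ∈ S.complexOrthogonal a) :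
    S.g ⁅y, w⁆ a = -2 * S.g (S.J y) w := by
  rw [S.lie_eq_connection_sub, map_sub, LinearMap.sub_apply, g_connection_left,
    S.g_connection_left w, S.symm w, S.symm y, ha.g_connection_orthogonal_self hG hy hw,
    ha.g_connection_orthogonal_self hG hw hy, S.g_J_left w, S.symm w]
  ring

theorem g_lie_orthogonal_J (hG : S.GrayFirst) (ha : S.IsAntiLeeVector a)
    (hy : y ∈ S.complexOrthogonal a) (hw : w ∈ S.complexOrthogonal a) :
    S.g ⁅y, w⁆ (S.J a) = 0 := by
  rw [S.lie_eq_connection_sub, map_sub, LinearMap.sub_apply, g_connection_left,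
    S.g_connection_left w, S.symm w, S.symm y, ha.g_connection_orthogonal_J hG hy hw,
    ha.g_connection_orthogonal_J hG hw hy, sub_self]

theorem g_self_mul_g_lie_self (hG : S.GrayFirst) (ha : S.IsAntiLeeVector a)
    (hy : y ∈ S.complexOrthogonal a) (v : 𝔤) :
    S.g a a * S.g ⁅y, v⁆ a = S.g v a * S.g y (S.connection a a)
      + S.g v (S.J a) * S.g y (S.J (S.connection a a)) - 2 * S.g a a * S.g (S.J y) v := by
  obtain ⟨p, q, w, hw, rfl⟩ := exists_eq_add_mem_complexOrthogonal (S := S) ha.ne_zero v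
  simp only [lie_add, lie_smul, map_add, map_smul, LinearMap.add_apply, LinearMap.smul_apply,
    smul_eq_mul, g_lie_right_self, ha.g_lie_J_self hG, ha.g_lie_orthogonal_self hG hy hw,
    g_self_J, g_J_self, J_orthogonal, mem_complexOrthogonal.1 hw,
    mem_complexOrthogonal.1 hy, S.g_J_left y a]
  ring

theorem g_self_mul_g_lie_J (hG : S.GrayFirst) (ha : S.IsAntiLeeVector a)
    (hy : y ∈ S.complexOrthogonal a) (v : 𝔤) :
    S.g a a * S.g ⁅y, v⁆ (S.J a) = S.g v a * S.g y (S.J (S.connection a a))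
      - S.g v (S.J a) * S.g y (S.connection a a) := by
  obtain ⟨p, q, w, hw, rfl⟩ := exists_eq_add_mem_complexOrthogonal (S := S) ha.ne_zero v
  simp only [lie_add, lie_smul, map_add, map_smul, LinearMap.add_apply, LinearMap.smul_apply,
    smul_eq_mul, ha.g_lie_self_J hG, ha.g_lie_J_J hG, ha.g_lie_orthogonal_J hG hy hw,
    g_self_J, g_J_self, J_orthogonal, mem_complexOrthogonal.1 hw, mem_complexOrthogonal.1 hy]
  ring

theorem g_lie_J_eq_zero (hG : S.GrayFirst) (ha : S.IsAntiLeeVector a)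
    (hy : y ∈ S.complexOrthogonal a) : S.g y ⁅y, S.J a⁆ = 0 := by
  rw [S.symm, S.lie_eq_connection_sub, map_sub, LinearMap.sub_apply, g_connection_self,
    ha.g_connection_orthogonal_J hG hy hy, sub_zero]

theorem g_lie_lie_J_self (hG : S.GrayFirst) (ha : S.IsAntiLeeVector a)
    (hy : y ∈ S.complexOrthogonal a) :
    S.g a a * S.g ⁅⁅y, S.J y⁆, a⁆ (S.J a)
      = -2 * (S.g y (S.connection a a) ^ 2 + S.g y (S.J (S.connection a a)) ^ 2) := by
  have hJy := J_mem_complexOrthogonal hy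
  rw [lie_lie, map_sub, LinearMap.sub_apply, mul_sub, ha.g_self_mul_g_lie_J hG hy,
    ha.g_self_mul_g_lie_J hG hJy]
  simp only [g_lie_right_self, ha.g_lie_self_J hG, mem_complexOrthogonal.1 hy,
    mem_complexOrthogonal.1 hJy, J_orthogonal, S.g_J_left y (S.connection a a)]
  ring

theorem g_lie_lie_J_J (hG : S.GrayFirst) (ha : S.IsAntiLeeVector a)
    (hy : y ∈ S.complexOrthogonal a) :
    S.g a a * S.g ⁅⁅y, S.J y⁆, S.J a⁆ a
      = 2 * (S.g y (S.connection a a) ^ 2 + S.g y (S.J (S.connection a a)) ^ 2) := by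
  have hJy := J_mem_complexOrthogonal hy
  rw [lie_lie, map_sub, LinearMap.sub_apply, mul_sub, ha.g_self_mul_g_lie_self hG hy,
    ha.g_self_mul_g_lie_self hG hJy, S.J_sq, map_neg, LinearMap.neg_apply, ha.g_lie_J_eq_zero hG hy,
    ha.g_lie_J_eq_zero hG hJy]
  simp only [ha.g_lie_J_self hG, ha.g_lie_J_J hG, mem_complexOrthogonal.1 hy,
    mem_complexOrthogonal.1 hJy, J_orthogonal, S.g_J_left y (S.connection a a)]
  ring

theorem g_self_mul_g_self_add (hG : S.GrayFirst) (ha : S.IsAntiLeeVector a)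
    (hy : y ∈ S.complexOrthogonal a) :
    S.g a a * S.g y y
      + 2 * (S.g y (S.connection a a) ^ 2 + S.g y (S.J (S.connection a a)) ^ 2) = 0 := by
  have hself := ha.g_lie_self_J hG ⁅y, S.J y⁆
  have hJ := ha.g_lie_J_self hG ⁅y, S.J y⁆
  have horth := ha.g_lie_orthogonal_self hG hy (J_mem_complexOrthogonal hy)
  rw [J_orthogonal] at horth
  linear_combination (S.g a a * (hJ - hself + horth) + ha.g_lie_lie_J_self hG hy
    - ha.g_lie_lie_J_J hG hy) / 2

theorem not_grayFirst (ha : S.IsAntiLeeVector a) : ¬ S.GrayFirst := fun hG => by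
  obtain ⟨y, hy, hy0⟩ := (Submodule.ne_bot_iff _).1 ha.complexOrthogonal_ne_bot
  have hpos := mul_pos (S.pos a ha.ne_zero) (S.pos y hy0)
  nlinarith [ha.g_self_mul_g_self_add hG hy]

end IsAntiLeeVector

end AlmostHermitianLieAlgebra

theorem proposition5p8 {𝔤 : Type*} [LieRing 𝔤] [LieAlgebra ℝ 𝔤] [FiniteDimensional ℝ 𝔤]
    (hdim : Module.finrank ℝ 𝔤 = 4) (S : AlmostHermitianLieAlgebra 𝔤)
    (hherm : S.IsHermitian) (hG : S.GrayFirst) : S.IsKahler := by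
  refine ⟨hherm, fun x y z => ?_⟩
  suffices hD : S.nablaJ = 0 by
    simp only [S.dOmega_eq_nablaJ, hD, LinearMap.zero_apply, map_zero, add_zero]
  by_contra hD
  obtain ⟨a, ha⟩ := AlmostHermitianLieAlgebra.exists_isAntiLeeVector hdim hherm hD
  exact ha.not_grayFirst hG
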